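/- Let $M_1>1$, $M_2>0$ be constants. For $n\ge 1$ and $p\ge 2$, consider the linear model $y=X\beta+\epsilon$ with $\beta\in\mathbb{R}^p$, where the rows $X_{1\cdot},\dots,X_{n\cdot}$ of $X\in\mathbb{R}^{n\times p}$ are i.i.d. $N_p(0,\Omega^{-1})$ and $\epsilon\sim N_n(0,\sigma^2 I)$ is independent of $X$; the data are $Z=(y_i,X_{i\cdot})_{i=1}^n$, with law $\mathbb{P}_\theta$ under $\theta=(\beta,\Omega,\sigma)$. For an integer $k\ge 0$ let $$\Theta(k)=\Big\{(\beta,\Omega,\sigma):\ \|\beta\|_0\le k,\ \tfrac1{M_1}\le\lambda_{\min}(\Omega)\le\lambda_{\max}(\Omega)\le M_1,\ 0<\sigma\le M_2\Big\},$$ where $\Omega$ ranges over symmetric $p\times p$ matrices and $\|\cdot\|_0$ is the number of nonzero coordinates. For $\xi\in\mathbb{R}^p$ and sets $\Theta_1\subseteq\Theta$ of parameters let $$L^*_\alpha(\Theta_1,\Theta,\xi^{\intercal}\beta)=\inf\ \sup_{\theta\in\Theta_1}\mathbb{E}_\theta\big(u(Z)-l(Z)\big)\in[0,\infty],$$ the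 infimum being over all intervals $[l(Z),u(Z)]$, with $l\le u$ measurable functions of the data, such that $\mathbb{P}_\theta\big(l(Z)\le\xi^{\intercal}\beta\le u(Z)\big)\ge 1-\alpha$ for every $\theta\in\Theta$ (and $\inf\emptyset=\infty$). Let $0<\alpha<\frac12$, $c>0$, $0\le\gamma<\frac12$, $2\gamma<\gamma_q\le 1$, $c_q>0$ and $\bar c\ge 1$. Then there is a constant $c_1>0$, depending only on $M_1,M_2,\alpha,c,\gamma,\gamma_q,c_q,\bar c$, such that for all $n\ge1$, $p\ge2$, all integers $0\le k_1\le k\le c\min\{p^{\gamma},\frac{n}{\log p}\}$, and every dense loading $\xi$, that is, every nonzero $\xi\in\mathbb{R}^p$ with $\|\xi\|_0=q\ge c_q\,p^{\gamma_q}$ and $\max_{j\in\mathrm{supp}(\xi)}|\xi_j|\le\bar c\,\min_{j\in\mathrm{supp}(\xi)}|\xi_j|$, $$L^*_\alpha\big(\Theta(k_1),\Theta(k),\xi^{\intercal}\beta\big)\ \ge\ c_1\,\|\xi\|_\infty\,k\,\sqrt{\frac{\log p}{n}}.$$ -/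

import Mathlib

open MeasureTheory ProbabilityTheory Matrix
open scoped ENNReal

noncomputable section

namespace HDRegression

/-- The parameter `θ = (β, Ω, σ)` of the linear model with Gaussian design: regression vector,
precision matrix of the rows of the design, and noise level. -/
structure Param (p : ℕ) where
  β : Fin p → ℝ
  Ω : Matrix (Fin p) (Fin p) ℝ
  σ : ℝ

/-- The data `Z = (Z_1, …, Z_n)` with `Z_i = (y_i, X_i)`, where `X_i ∈ ℝ^p` is the `i`-th row
of the design matrix. -/
abbrev Data (n p : ℕ) : Type := Fin n → ℝ × EuclideanSpace ℝ (Fin p)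

/-- The law of one observation `(y, x)`: `x ∼ N_p(0, Ω⁻¹)`, `ε ∼ N(0, σ²)` independent of `x`,
and `y = xᵀβ + ε`. -/
def rowLaw {p : ℕ} (θ : Param p) : Measure (ℝ × EuclideanSpace ℝ (Fin p)) :=
  ((multivariateGaussian 0 θ.Ω⁻¹).prod (gaussianReal 0 (Real.toNNReal (θ.σ ^ 2)))).map
    (fun w => ((∑ j, w.1 j * θ.β j) + w.2, w.1))

/-- `ℙ_θ`: the law of `n` i.i.d. observations. -/
def dataLaw (n : ℕ) {p : ℕ} (θ : Param p) : Measure (Data n p) :=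
  Measure.pi (fun _ : Fin n => rowLaw θ)

/-- `‖v‖₀`, the number of nonzero coordinates. -/
def l0 {p : ℕ} (v : Fin p → ℝ) : ℕ := (Finset.univ.filter (fun j => v j ≠ 0)).card

/-- The parameter space `Θ(k)` (with the constants `M₁`, `M₂`): `‖β‖₀ ≤ k`, `Ω` symmetric with all
its eigenvalues in `[1/M₁, M₁]`, and `0 < σ ≤ M₂`. -/
def Theta (M₁ M₂ : ℝ) {p : ℕ} (k : ℕ) : Set (Param p) :=
  {θ | l0 θ.β ≤ k ∧
    (∃ h : θ.Ω.IsHermitian, ∀ i, 1 / M₁ ≤ h.eigenvalues i ∧ h.eigenvalues i ≤ M₁) ∧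
    0 < θ.σ ∧ θ.σ ≤ M₂}

/-- An interval `[l(Z), u(Z)]` computed from the data. -/
structure Interval (n p : ℕ) where
  l : Data n p → ℝ
  u : Data n p → ℝ
  measurable_l : Measurable l
  measurable_u : Measurable u
  l_le_u : ∀ z, l z ≤ u z

/-- `𝓘_α(Θ, T)`: the `(1 - α)`-level confidence intervals for `T(β)` over `Θ`. -/
def confidenceIntervals (α : ℝ) {n p : ℕ} (Θ : Set (Param p)) (T : (Fin p → ℝ) → ℝ) :
    Set (Interval n p) :=
  {I | ∀ θ ∈ Θ,
    ENNReal.ofReal (1 - α) ≤ dataLaw n θ {z | I.l z ≤ T θ.β ∧ T θ.β ≤ I.u z}}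

/-- The maximum expected length `sup_{θ ∈ Θ} 𝔼_θ (u(Z) - l(Z))`, with values in `[0, ∞]`. -/
def maxExpectedLength {n p : ℕ} (I : Interval n p) (Θ : Set (Param p)) : ℝ≥0∞ :=
  ⨆ θ ∈ Θ, ∫⁻ z, ENNReal.ofReal (I.u z - I.l z) ∂(dataLaw n θ)

/-- The benchmark `L*_α(Θ₁, Θ, T)` for sample size `n`: the infimum of the maximum expected length
over `Θ₁` among all `(1 - α)`-level confidence intervals for `T(β)` over `Θ`. -/
def benchmark (α : ℝ) (n : ℕ) {p : ℕ} (Θ₁ Θ : Set (Param p)) (T : (Fin p → ℝ) → ℝ) : ℝ≥0∞ :=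
  ⨅ I ∈ confidenceIntervals (n := n) α Θ T, maxExpectedLength I Θ₁

/-- The class `Ξ(q, c̄)` of loadings: `‖ξ‖₀ = q`, `ξ ≠ 0`, and the ratio of the largest to the
smallest absolute value on the support is at most `c̄`. -/
def Loading {p : ℕ} (q : ℕ) (cbar : ℝ) : Set (Fin p → ℝ) :=
  {ξ | l0 ξ = q ∧ ξ ≠ 0 ∧ ∀ i j, ξ i ≠ 0 → ξ j ≠ 0 → |ξ i| / |ξ j| ≤ cbar}

end HDRegression

end

noncomputable section

/-! The bound comes from testing one null against a sparse mixture. The null `β = 0`, `Ω = 1`, `σ =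
M₂` lies in every `Theta M₁ M₂ k₁`. The alternatives place `k` spikes of height `ρ`, signed like
`ξ`, one at a uniform position in each of `k` disjoint blocks of the support of `ξ`, so all of them
have `ξᵀβ` at least of order `‖ξ‖ k ρ`. Lowering `σ²` by `‖β‖²` keeps the law of the response
unchanged, so only its covariance with the design betrays the signal.

With this matching, two likelihood ratios have the mixed moment `(1 - ⟪a, b⟫ / M₂²)⁻ⁿ`
(`lintegral_likelihoodRatio_mul`). The overlap of two independent choices is binomial, so the second
moment of the mixture is at most `exp (k (e^τ - 1) / b)`, with `τ = 2nρ²/M₂²` and `b` the block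
size. For `ρ² = M₂² t log p / n` and `b` about `q / k`, the exponent is of order `k² p^(2t) / q`,
which vanishes for small `t` because `2γ < γq`. By `le_measure_add_of_second_moment`, the upper end
of the interval then reaches the common signal level under the null as well, while the interval must
also cover `0`. For bounded `p`, a single spike of height of order `n^(-1/2)` suffices. -/

namespace HDRegression

open scoped NNReal RealInnerProductSpace

/-! ### Product measures and densities -/

/-- The integral of a product of functions of the separate coordinates factorizes. -/
theorem lintegral_pi_prod {ι Ω : Type*} [Fintype ι] [MeasurableSpace Ω] (μ : Measure Ω)
    [IsProbabilityMeasure μ] {f : ι → Ω → ℝ≥0∞} (hf : ∀ i, Measurable (f i)) :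
    ∫⁻ z, ∏ i, f i (z i) ∂(Measure.pi fun _ : ι => μ) = ∏ i, ∫⁻ x, f i x ∂μ := by
  rw [lintegral_prod_eq_prod_lintegral_of_indepFun Finset.univ (fun i (z : ι → Ω) => f i (z i))
    (iIndepFun_pi fun i => (hf i).aemeasurable) fun i => (hf i).comp (measurable_pi_apply i)]
  refine Finset.prod_congr rfl fun i _ => ?_
  exact (measurePreserving_eval (fun _ : ι => μ) i).lintegral_comp (hf i)

/-- A product of measures with densities has the product density. -/
theorem pi_withDensity {ι Ω : Type*} [Fintype ι] [MeasurableSpace Ω] (μ : Measure Ω)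
    [IsProbabilityMeasure μ] {f : Ω → ℝ≥0∞} (hf : Measurable f)
    [IsProbabilityMeasure (μ.withDensity f)] :
    Measure.pi (fun _ : ι => μ.withDensity f) =
      (Measure.pi fun _ : ι => μ).withDensity (fun z => ∏ i, f (z i)) := by
  refine Measure.pi_eq fun s hs => ?_
  rw [withDensity_apply _ (MeasurableSet.univ_pi hs),
    ← lintegral_indicator (MeasurableSet.univ_pi hs)]
  have : ∀ z : ι → Ω, (Set.univ.pi s).indicator (fun z => ∏ i, f (z i)) z =
      ∏ i, (s i).indicator f (z i) := by
    intro z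
    by_cases hz : z ∈ Set.univ.pi s
    · rw [Set.indicator_of_mem hz]
      exact Finset.prod_congr rfl fun i _ => (Set.indicator_of_mem (hz i trivial) _).symm
    · rw [Set.indicator_of_notMem hz]
      obtain ⟨i, hi⟩ : ∃ i, z i ∉ s i := by simpa [Set.mem_pi] using hz
      exact (Finset.prod_eq_zero (Finset.mem_univ i) (Set.indicator_of_notMem hi _)).symm
  simp_rw [this]
  rw [lintegral_pi_prod μ fun i => hf.indicator (hs i)]
  refine Finset.prod_congr rfl fun i _ => ?_
  rw [withDensity_apply _ (hs i), lintegral_indicator (hs i)]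

/-! ### Likelihood ratios in Gaussian regression -/

/-- The likelihood ratio of `y ∼ N(s(x), v)` against `y ∼ N(0, v₀)`. -/
def likelihoodRatio {E : Type*} (v v₀ : ℝ≥0) (s : E → ℝ) (z : ℝ × E) : ℝ≥0∞ :=
  gaussianPDF (s z.2) v z.1 / gaussianPDF 0 v₀ z.1

theorem measurable_gaussianPDF_uncurry (v : ℝ≥0) :
    Measurable fun q : ℝ × ℝ => gaussianPDF q.1 v q.2 :=
  measurable_uncurry_gaussianPDF.comp (f := fun q : ℝ × ℝ => (q.1, v, q.2)) (by fun_prop)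

theorem measurable_likelihoodRatio {E : Type*} [MeasurableSpace E] (v v₀ : ℝ≥0) {s : E → ℝ}
    (hs : Measurable s) : Measurable (likelihoodRatio v v₀ s) := by
  refine Measurable.div ?_ ((measurable_gaussianPDF 0 v₀).comp measurable_fst)
  exact (measurable_gaussianPDF_uncurry v).comp
    (f := fun z : ℝ × E => (s z.2, z.1)) (by fun_prop)

/-- Changing the conditional mean and the variance of Gaussian responses is a change of density. -/
theorem map_regression_eq_withDensity {E : Type*} [MeasurableSpace E] (μ : Measure E)
    [IsProbabilityMeasure μ] {s : E → ℝ} (hs : Measurable s) {v v₀ : ℝ≥0} (hv : v ≠ 0)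
    (hv₀ : v₀ ≠ 0) :
    (μ.prod (gaussianReal 0 v)).map (fun w => (s w.1 + w.2, w.1)) =
      ((μ.prod (gaussianReal 0 v₀)).map (fun w => (w.2, w.1))).withDensity
        (likelihoodRatio v v₀ s) := by
  refine Measure.ext_of_lintegral _ fun f hf => ?_
  have hL := measurable_likelihoodRatio v v₀ hs
  have hLf : Measurable fun w : E × ℝ => (likelihoodRatio v v₀ s * f) (w.2, w.1) :=
    (hL.mul hf).comp (by fun_prop)
  rw [lintegral_map hf (by fun_prop), lintegral_withDensity_eq_lintegral_mul _ hL hf,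
    lintegral_map (hL.mul hf) (by fun_prop), lintegral_prod _ (by fun_prop),
    lintegral_prod _ hLf.aemeasurable]
  refine lintegral_congr fun x => ?_
  have h1 : ∫⁻ e, f (s x + e, x) ∂(gaussianReal 0 v) =
      ∫⁻ y, f (y, x) ∂(gaussianReal (s x) v) := by
    conv_rhs => rw [← zero_add (s x), ← gaussianReal_map_const_add]
    rw [lintegral_map (by fun_prop) (by fun_prop)]
  have hpdf := measurable_gaussianPDF 0 v₀
  have hm : Measurable fun y => (likelihoodRatio v v₀ s * f) (y, x) :=
    (hL.mul hf).comp (by fun_prop)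
  change ∫⁻ e, f (s x + e, x) ∂(gaussianReal 0 v) = _
  rw [h1, gaussianReal_of_var_ne_zero _ hv, gaussianReal_of_var_ne_zero _ hv₀,
    lintegral_withDensity_eq_lintegral_mul _ (measurable_gaussianPDF _ _) (by fun_prop),
    lintegral_withDensity_eq_lintegral_mul _ hpdf hm]
  refine lintegral_congr fun y => ?_
  simp only [Pi.mul_apply, likelihoodRatio]
  rw [← mul_assoc, ENNReal.mul_div_cancel (gaussianPDF_pos 0 hv₀ y).ne' gaussianPDF_ne_top]

/-- A centred Gaussian density whose mean depends linearly on its argument. -/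
theorem lintegral_gaussianPDF_linear_mean {κ : ℝ} (hκ : κ < 1) {v : ℝ≥0} (hv : v ≠ 0) (t : ℝ) :
    ∫⁻ y, gaussianPDF (κ * y + t) v y = ENNReal.ofReal (1 - κ)⁻¹ := by
  have hc : 1 - κ ≠ 0 := by linarith
  have : ∀ y, gaussianPDF (κ * y + t) v y = ENNReal.ofReal (1 - κ)⁻¹ *
      gaussianPDF ((1 - κ)⁻¹ * t) (NNReal.mk ((1 - κ) ^ 2)⁻¹ (by positivity) * v) y := by
    intro y
    -- Only the difference `(1 - κ) y - t` enters, so this is a fixed Gaussian density at a rescaled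
    -- argument.
    have h2 : gaussianPDFReal (κ * y + t) v y = gaussianPDFReal t v ((1 - κ) * y) := by
      simp only [gaussianPDFReal]
      ring_nf
    rw [gaussianPDF, h2, gaussianPDFReal_mul hc,
      abs_of_pos (inv_pos.2 (by linarith : (0 : ℝ) < 1 - κ)),
      ENNReal.ofReal_mul (inv_nonneg.2 (by linarith)), gaussianPDF]
  simp_rw [this]
  rw [lintegral_const_mul _ (measurable_gaussianPDF _ _), lintegral_gaussianPDF_eq_one, mul_one]
  refine mul_ne_zero (fun h => ?_) hv
  have := congrArg NNReal.toReal h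
  simp at this
  exact hc this

section

variable {E : Type*} [NormedAddCommGroup E] [InnerProductSpace ℝ E] [FiniteDimensional ℝ E]
  [MeasurableSpace E] [BorelSpace E]

/-- The joint law of the response `⟪a, x⟫ + e` and of `⟪b, x⟫`, disintegrated along the
response. -/
theorem map_response_inner (a b : E) {v v₀ r : ℝ≥0} (hv₀ : v₀ ≠ 0)
    (h₀ : ‖a‖ ^ 2 + v = v₀) (hr : ⟪a, b⟫ ^ 2 / v₀ + r = ‖b‖ ^ 2) :
    ((stdGaussian E).prod (gaussianReal 0 v)).map (fun w => (⟪a, w.1⟫ + w.2, ⟪b, w.1⟫)) =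
      ((gaussianReal 0 v₀).prod (gaussianReal 0 r)).map
        (fun w => (w.1, ⟪a, b⟫ / v₀ * w.1 + w.2)) := by
  let A : E × ℝ →L[ℝ] ℝ × ℝ :=
    ((innerSL ℝ a).comp (ContinuousLinearMap.fst ℝ E ℝ) + ContinuousLinearMap.snd ℝ E ℝ).prod
      ((innerSL ℝ b).comp (ContinuousLinearMap.fst ℝ E ℝ))
  let B : ℝ × ℝ →L[ℝ] ℝ × ℝ :=
    (ContinuousLinearMap.fst ℝ ℝ ℝ).prod
      ((⟪a, b⟫ / v₀) • (ContinuousLinearMap.fst ℝ ℝ ℝ) + ContinuousLinearMap.snd ℝ ℝ ℝ)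
  change Measure.map A _ = Measure.map B _
  have : IsProbabilityMeasure (((stdGaussian E).prod (gaussianReal 0 v)).map A) :=
    Measure.isProbabilityMeasure_map (by fun_prop)
  have : IsProbabilityMeasure (((gaussianReal 0 v₀).prod (gaussianReal 0 r)).map B) :=
    Measure.isProbabilityMeasure_map (by fun_prop)
  refine Measure.ext_of_charFunDual ?_
  ext M
  have hreal : ∀ (u : ℝ≥0) (N : StrongDual ℝ ℝ),
      charFunDual (gaussianReal 0 u) N = Complex.exp (-((u * (N 1) ^ 2 / 2 : ℝ) : ℂ)) := by
    intro u N
    have : charFunDual (gaussianReal 0 u) N = charFun (gaussianReal 0 u) (N 1) := by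
      rw [charFunDual_apply, charFun_apply_real]
      refine integral_congr_ae (.of_forall fun x => ?_)
      have : N x = N 1 * x := by
        conv_lhs => rw [← mul_one x, ← smul_eq_mul, map_smul, smul_eq_mul, mul_comm]
      simp [this]
    rw [this, charFun_gaussianReal]
    congr 1
    push_cast
    ring
  rw [charFunDual_map, charFunDual_map, charFunDual_prod, charFunDual_prod,
    charFunDual_stdGaussian, hreal, hreal, hreal, ← Complex.exp_add, ← Complex.exp_add]
  set m₁ := M (1, 0) with hm₁
  set m₂ := M (0, 1) with hm₂
  have hM : ∀ s t, M (s, t) = s * m₁ + t * m₂ := by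
    intro s t
    have : ((s, t) : ℝ × ℝ) = s • (1, 0) + t • (0, 1) := by simp
    rw [this, map_add, map_smul, map_smul, smul_eq_mul, smul_eq_mul]
  have e1 : (M ∘SL A) ∘SL ContinuousLinearMap.inl ℝ E ℝ = innerSL ℝ (m₁ • a + m₂ • b) := by
    ext x
    simp [A, hM]
    ring
  have e2 : ((M ∘SL A) ∘SL ContinuousLinearMap.inr ℝ E ℝ) 1 = m₁ := by
    simp [A, hM]
  have e3 : ((M ∘SL B) ∘SL ContinuousLinearMap.inl ℝ ℝ ℝ) 1 = m₁ + ⟪a, b⟫ / v₀ * m₂ := by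
    simp [B, hM]
  have e4 : ((M ∘SL B) ∘SL ContinuousLinearMap.inr ℝ ℝ ℝ) 1 = m₂ := by
    simp [B, hM]
  have hnorm : ‖m₁ • a + m₂ • b‖ ^ 2 =
      m₁ ^ 2 * ‖a‖ ^ 2 + 2 * (m₁ * m₂ * ⟪a, b⟫) + m₂ ^ 2 * ‖b‖ ^ 2 := by
    rw [norm_add_sq_real, norm_smul, norm_smul, inner_smul_left, inner_smul_right, mul_pow,
      mul_pow, Real.norm_eq_abs, Real.norm_eq_abs, sq_abs, sq_abs]
    simp
    ring
  rw [e1, e2, e3, e4, innerSL_apply_norm]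
  congr 1
  norm_cast
  rw [hnorm, ← hr]
  have hv' : (v₀ : ℝ) ≠ 0 := by exact_mod_cast hv₀
  have : (v : ℝ) = v₀ - ‖a‖ ^ 2 := by linarith
  rw [this]
  field_simp
  ring

/-- The mixed second moment of two likelihood ratios with matched response variances. -/
theorem lintegral_likelihoodRatio_mul (a b : E) {v v₀ : ℝ≥0} (hv : v ≠ 0) (hv₀ : v₀ ≠ 0)
    (ha : ‖a‖ ^ 2 + v = v₀) (hb : ‖b‖ ^ 2 + v = v₀) :
    ∫⁻ z, likelihoodRatio v v₀ (fun x => ⟪a, x⟫) z * likelihoodRatio v v₀ (fun x => ⟪b, x⟫) z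
        ∂(((stdGaussian E).prod (gaussianReal 0 v₀)).map fun w => (w.2, w.1)) =
      ENNReal.ofReal (1 - ⟪a, b⟫ / v₀)⁻¹ := by
  have hLa := measurable_likelihoodRatio v v₀ (s := fun x : E => ⟪a, x⟫) (by fun_prop)
  have hLb := measurable_likelihoodRatio v v₀ (s := fun x : E => ⟪b, x⟫) (by fun_prop)
  have hvp : (0 : ℝ) < v := by exact_mod_cast pos_iff_ne_zero.2 hv
  have hv₀p : (0 : ℝ) < v₀ := by exact_mod_cast pos_iff_ne_zero.2 hv₀
  have hab : ‖a‖ = ‖b‖ := by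
    rw [← sq_eq_sq₀ (norm_nonneg _) (norm_nonneg _)]; linarith
  have hcs : |⟪a, b⟫| ≤ ‖b‖ ^ 2 := by
    refine (abs_real_inner_le_norm a b).trans ?_
    rw [hab, sq]
  have hκ : ⟪a, b⟫ / v₀ < 1 := by
    rw [div_lt_one hv₀p]
    linarith [le_abs_self ⟪a, b⟫]
  have hsq : ⟪a, b⟫ ^ 2 / v₀ ≤ ‖b‖ ^ 2 := by
    rw [div_le_iff₀ hv₀p, ← sq_abs, sq]
    exact mul_le_mul hcs (by linarith) (abs_nonneg _) (by positivity)
  -- `r` is the conditional variance of `⟪b, x⟫` given the response; it is nonnegative by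
  -- Cauchy–Schwarz and `‖b‖² ≤ v₀`.
  obtain ⟨r, hr⟩ : ∃ r : ℝ≥0, ⟪a, b⟫ ^ 2 / v₀ + r = ‖b‖ ^ 2 :=
    ⟨NNReal.mk (‖b‖ ^ 2 - ⟪a, b⟫ ^ 2 / v₀) (by linarith), by rw [NNReal.coe_mk]; ring⟩
  have hlaw := map_response_inner a b hv₀ ha hr
  have step : ∀ f : ℝ × ℝ → ℝ≥0∞, Measurable f →
      ∫⁻ w, f (⟪a, w.1⟫ + w.2, ⟪b, w.1⟫) ∂((stdGaussian E).prod (gaussianReal 0 v)) =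
      ∫⁻ w, f (w.1, ⟪a, b⟫ / v₀ * w.1 + w.2)
        ∂((gaussianReal 0 v₀).prod (gaussianReal 0 r)) := by
    intro f hf
    rw [← lintegral_map hf (g := fun w : E × ℝ => (⟪a, w.1⟫ + w.2, ⟪b, w.1⟫)) (by fun_prop),
      hlaw, lintegral_map hf (by fun_prop)]
  have hf : Measurable fun q : ℝ × ℝ => gaussianPDF q.2 v q.1 / gaussianPDF 0 v₀ q.1 :=
    Measurable.div ((measurable_gaussianPDF_uncurry v).comp
      (f := fun q : ℝ × ℝ => (q.2, q.1)) (by fun_prop))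
      ((measurable_gaussianPDF 0 v₀).comp measurable_fst)
  -- One ratio is absorbed into the measure: the mixed moment is the mean of the second ratio under
  -- the first alternative.
  have h1 := lintegral_withDensity_eq_lintegral_mul
    (((stdGaussian E).prod (gaussianReal 0 v₀)).map fun w => (w.2, w.1)) hLa hLb
  rw [← map_regression_eq_withDensity _ (by fun_prop) hv hv₀,
    lintegral_map hLb (by fun_prop)] at h1
  refine h1.symm.trans ((step _ hf).trans ?_)
  have hf' : Measurable fun w : ℝ × ℝ =>
      gaussianPDF (⟪a, b⟫ / v₀ * w.1 + w.2) v w.1 / gaussianPDF 0 v₀ w.1 :=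
    hf.comp (f := fun w : ℝ × ℝ => (w.1, ⟪a, b⟫ / v₀ * w.1 + w.2)) (by fun_prop)
  refine (lintegral_prod_symm _ hf'.aemeasurable).trans ?_
  -- Since the response still has variance `v₀`, its density cancels the denominator, and the
  -- integral no longer depends on the residual `t`.
  have inner_eq : ∀ t, ∫⁻ y, gaussianPDF (⟪a, b⟫ / v₀ * y + t) v y / gaussianPDF 0 v₀ y
      ∂(gaussianReal 0 v₀) = ENNReal.ofReal (1 - ⟪a, b⟫ / v₀)⁻¹ := by
    intro t
    have hft : Measurable fun y => gaussianPDF (⟪a, b⟫ / v₀ * y + t) v y / gaussianPDF 0 v₀ y :=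
      hf.comp (f := fun y : ℝ => (y, ⟪a, b⟫ / v₀ * y + t)) (by fun_prop)
    rw [gaussianReal_of_var_ne_zero _ hv₀, lintegral_withDensity_eq_lintegral_mul _
      (measurable_gaussianPDF _ _) hft,
      ← lintegral_gaussianPDF_linear_mean hκ hv t]
    refine lintegral_congr fun y => ?_
    simp only [Pi.mul_apply]
    exact ENNReal.mul_div_cancel (gaussianPDF_pos 0 hv₀ y).ne' gaussianPDF_ne_top
  refine (lintegral_congr inner_eq).trans ?_
  simp

end

/-! ### From second moments to probabilities -/

/-- **Second moment method.** If the average of the densities `L i` has second moment at most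
`1 + ε²`, an event that has probability at least `t` under all the `L i` loses at most `ε`. -/
theorem le_measure_add_of_second_moment {ι Ω : Type*} [Fintype ι] [Nonempty ι]
    [MeasurableSpace Ω] (μ : Measure Ω) [IsProbabilityMeasure μ] {L : ι → Ω → ℝ≥0∞}
    (hL : ∀ i, Measurable (L i)) (h1 : ∀ i, ∫⁻ z, L i z ∂μ = 1) {ε : ℝ} (hε : 0 < ε)
    (h2 : ∑ i, ∑ j, ∫⁻ z, L i z * L j z ∂μ ≤
      (Fintype.card ι : ℝ≥0∞) ^ 2 * ENNReal.ofReal (1 + ε ^ 2))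
    {B : Set Ω} (hB : MeasurableSet B) {t : ℝ≥0∞} (ht : ∀ i, t ≤ (μ.withDensity (L i)) B) :
    t ≤ μ B + ENNReal.ofReal ε := by
  set N : ℝ≥0∞ := (Fintype.card ι : ℝ≥0∞) with hN
  have hN0 : N ≠ 0 := by simp [hN]
  have hNt : N ≠ ∞ := by simp [hN]
  let A : Ω → ℝ≥0∞ := fun z => N⁻¹ * ∑ i, L i z
  have hA : Measurable A := by fun_prop
  have hA1 : ∫⁻ z, A z ∂μ = 1 := by
    rw [lintegral_const_mul _ (by fun_prop), lintegral_finsetSum _ fun i _ => hL i]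
    simp [h1, ENNReal.inv_mul_cancel hN0 hNt, ← hN]
  have hA2 : ∫⁻ z, A z ^ 2 ∂μ ≤ ENNReal.ofReal (1 + ε ^ 2) := by
    have : ∀ z, A z ^ 2 = (N⁻¹) ^ 2 * ∑ i, ∑ j, L i z * L j z := by
      intro z
      simp only [A]
      rw [mul_pow, sq (∑ i, L i z), Finset.sum_mul_sum]
    simp_rw [this]
    rw [lintegral_const_mul _ (by fun_prop), lintegral_finsetSum _ fun i _ => by fun_prop]
    have hLL : ∀ i, ∫⁻ z, ∑ j, L i z * L j z ∂μ = ∑ j, ∫⁻ z, L i z * L j z ∂μ := fun i =>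
      lintegral_finsetSum _ fun j _ => (hL i).mul (hL j)
    simp_rw [hLL]
    calc _ ≤ (N⁻¹) ^ 2 * (N ^ 2 * ENNReal.ofReal (1 + ε ^ 2)) := by gcongr
      _ = _ := by
        rw [← mul_assoc, ← mul_pow, ENNReal.inv_mul_cancel hN0 hNt, one_pow, one_mul]
  have hAB : t ≤ ∫⁻ z in B, A z ∂μ := by
    rw [lintegral_const_mul _ (by fun_prop), lintegral_finsetSum _ fun i _ => hL i]
    calc t = N⁻¹ * ∑ _i : ι, t := by
          rw [Finset.sum_const, Finset.card_univ, nsmul_eq_mul, ← mul_assoc,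
            ENNReal.inv_mul_cancel hN0 hNt, one_mul]
      _ ≤ _ := by
          gcongr with i
          rw [← withDensity_apply _ hB]
          exact ht i
  clear_value A
  -- This is `1_B (A - 1) ≤ ε/2 + (A - 1)²/(2ε)`, with the cross term `A/ε` moved to the left to
  -- avoid subtraction in `ℝ≥0∞`.
  have hpt : ∀ z, B.indicator A z + ENNReal.ofReal ε⁻¹ * A z ≤
      B.indicator 1 z + (ENNReal.ofReal (ε / 2 + 1 / (2 * ε)) +
        ENNReal.ofReal (1 / (2 * ε)) * A z ^ 2) := by
    intro z
    rcases eq_or_ne (A z) ∞ with hz | hz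
    · rw [hz]
      have : ENNReal.ofReal (1 / (2 * ε)) ≠ 0 := by
        rw [Ne, ENNReal.ofReal_eq_zero, not_le]
        positivity
      simp only [ne_eq, OfNat.ofNat_ne_zero, not_false_eq_true, ENNReal.top_pow,
        ENNReal.mul_top this, add_top, le_top]
    · obtain ⟨x, hx0, hx⟩ : ∃ x : ℝ, 0 ≤ x ∧ A z = ENNReal.ofReal x :=
        ⟨(A z).toReal, ENNReal.toReal_nonneg, (ENNReal.ofReal_toReal hz).symm⟩
      have hi : ε⁻¹ * x ≤ ε / 2 + 1 / (2 * ε) + 1 / (2 * ε) * x ^ 2 := by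
        rw [← sub_nonneg]
        have : ε / 2 + 1 / (2 * ε) + 1 / (2 * ε) * x ^ 2 - ε⁻¹ * x =
          ε / 2 + (x - 1) ^ 2 / (2 * ε) := by field_simp; ring
        rw [this]; positivity
      have hi' : x + ε⁻¹ * x ≤ 1 + (ε / 2 + 1 / (2 * ε) + 1 / (2 * ε) * x ^ 2) := by
        rw [← sub_nonneg]
        have : 1 + (ε / 2 + 1 / (2 * ε) + 1 / (2 * ε) * x ^ 2) - (x + ε⁻¹ * x) =
          (x - 1 - ε) ^ 2 / (2 * ε) := by field_simp; ring
        rw [this]; positivity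
      by_cases hzB : z ∈ B
      · simp only [Set.indicator_of_mem hzB, hx, Pi.one_apply]
        rw [← ENNReal.ofReal_pow hx0, ← ENNReal.ofReal_mul (by positivity),
          ← ENNReal.ofReal_mul (by positivity), ← ENNReal.ofReal_add hx0 (by positivity),
          ← ENNReal.ofReal_add (by positivity) (by positivity), ← ENNReal.ofReal_one,
          ← ENNReal.ofReal_add (by positivity) (by positivity)]
        exact ENNReal.ofReal_le_ofReal hi'
      · simp only [Set.indicator_of_notMem hzB, hx, zero_add]
        rw [← ENNReal.ofReal_pow hx0, ← ENNReal.ofReal_mul (by positivity),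
          ← ENNReal.ofReal_mul (by positivity),
          ← ENNReal.ofReal_add (by positivity) (by positivity)]
        exact ENNReal.ofReal_le_ofReal hi
  have hint := lintegral_mono (μ := μ) hpt
  rw [lintegral_add_left (hA.indicator hB), lintegral_indicator hB, lintegral_const_mul _ hA, hA1,
    lintegral_add_left (measurable_one.indicator hB), lintegral_indicator_one hB,
    lintegral_add_left measurable_const, lintegral_const, measure_univ,
    lintegral_const_mul _ (by fun_prop), mul_one, mul_one] at hint
  have hfin : ENNReal.ofReal (ε / 2 + 1 / (2 * ε)) +
      ENNReal.ofReal (1 / (2 * ε)) * ∫⁻ z, A z ^ 2 ∂μ ≤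
      ENNReal.ofReal ε + ENNReal.ofReal ε⁻¹ := by
    calc _ ≤ ENNReal.ofReal (ε / 2 + 1 / (2 * ε)) +
          ENNReal.ofReal (1 / (2 * ε)) * ENNReal.ofReal (1 + ε ^ 2) := by gcongr
      _ = _ := by
        rw [← ENNReal.ofReal_mul (by positivity),
          ← ENNReal.ofReal_add (by positivity) (by positivity),
          ← ENNReal.ofReal_add (by positivity) (by positivity)]
        congr 1
        field_simp
        ring
  have : t + ENNReal.ofReal ε⁻¹ ≤ (μ B + ENNReal.ofReal ε) + ENNReal.ofReal ε⁻¹ := by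
    calc _ ≤ _ := add_le_add_left hAB _
      _ ≤ _ := hint
      _ ≤ _ := by rw [add_assoc]; gcongr
  exact (ENNReal.add_le_add_iff_right ENNReal.ofReal_ne_top).1 this

/-! ### The sparse prior and its overlaps -/

section Spikes

variable {p m b : ℕ}

/-- The vector with the entry `a j` at the positions `j = e (i, f i)`, one in each of the `m` blocks
`e (i, ·)`. -/
def spikes (e : Fin m × Fin b ↪ Fin p) (a : Fin p → ℝ) (f : Fin m → Fin b) :
    EuclideanSpace ℝ (Fin p) :=
  ∑ i, EuclideanSpace.single (e (i, f i)) (a (e (i, f i)))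

/-- The number of blocks in which two choices of positions agree. -/
def overlap (f g : Fin m → Fin b) : ℕ := (Finset.univ.filter fun i => f i = g i).card

theorem overlap_le (f g : Fin m → Fin b) : overlap f g ≤ m :=
  (Finset.card_filter_le _ _).trans (by simp)

theorem overlap_self (f : Fin m → Fin b) : overlap f f = m := by simp [overlap]

/-- As `e` is injective, distinct blocks never share a coordinate; only blocks where the choices
agree contribute, and the signs cancel there. -/
theorem inner_spikes (e : Fin m × Fin b ↪ Fin p) {a : Fin p → ℝ} {ρ : ℝ}
    (ha : ∀ x, a (e x) ^ 2 = ρ ^ 2) (f g : Fin m → Fin b) :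
    ⟪spikes e a f, spikes e a g⟫ = overlap f g * ρ ^ 2 := by
  have : ∀ i j, ⟪EuclideanSpace.single (e (i, f i)) (a (e (i, f i))),
      EuclideanSpace.single (e (j, g j)) (a (e (j, g j)))⟫ =
      if i = j then (if f i = g i then ρ ^ 2 else 0) else 0 := by
    intro i j
    rw [EuclideanSpace.inner_single_left]
    by_cases hij : i = j
    · subst hij
      by_cases hfg : f i = g i
      · simp [hfg, ← ha (i, g i), sq]
      · simp [hfg]
    · simp [hij]
  simp only [spikes, sum_inner, inner_sum, this]
  simp [overlap, Finset.sum_ite]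

theorem norm_sq_spikes (e : Fin m × Fin b ↪ Fin p) {a : Fin p → ℝ} {ρ : ℝ}
    (ha : ∀ x, a (e x) ^ 2 = ρ ^ 2) (f : Fin m → Fin b) :
    ‖spikes e a f‖ ^ 2 = m * ρ ^ 2 := by
  rw [← real_inner_self_eq_norm_sq, inner_spikes e ha, overlap_self]

theorem l0_spikes_le (e : Fin m × Fin b ↪ Fin p) (a : Fin p → ℝ) (f : Fin m → Fin b) :
    l0 (spikes e a f).ofLp ≤ m := by
  have : (Finset.univ.filter fun j => (spikes e a f).ofLp j ≠ 0) ⊆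
      Finset.univ.image fun i => e (i, f i) := by
    intro j hj
    by_contra hne
    refine (Finset.mem_filter.1 hj).2 ?_
    simp only [Finset.mem_image, Finset.mem_univ, true_and, not_exists] at hne
    simp only [spikes, WithLp.ofLp_sum, Finset.sum_apply]
    refine Finset.sum_eq_zero fun i _ => ?_
    simp [Ne.symm (hne i)]
  exact (Finset.card_le_card this).trans (Finset.card_image_le.trans (by simp))

theorem sum_mul_spikes (e : Fin m × Fin b ↪ Fin p) (a ξ : Fin p → ℝ) (f : Fin m → Fin b) :
    ∑ j, ξ j * (spikes e a f).ofLp j = ∑ i, ξ (e (i, f i)) * a (e (i, f i)) := by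
  simp only [spikes, WithLp.ofLp_sum, Finset.sum_apply, Finset.mul_sum]
  rw [Finset.sum_comm]
  simp

/-- The exponential moment of the overlap of two independent uniform choices. -/
theorem sum_exp_overlap (t : ℝ) :
    ∑ f : Fin m → Fin b, ∑ g : Fin m → Fin b, Real.exp (t * overlap f g) =
      (b : ℝ) ^ m * (b + (Real.exp t - 1)) ^ m := by
  -- The exponential splits into one factor per block, so the sum over choices becomes a product of
  -- sums over positions.
  have h1 : ∀ f g : Fin m → Fin b, Real.exp (t * overlap f g) =
      ∏ i, (1 + if f i = g i then Real.exp t - 1 else 0) := by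
    intro f g
    have : ∀ i, (1 + if f i = g i then Real.exp t - 1 else 0) =
        if f i = g i then Real.exp t else 1 := fun i => by split_ifs <;> simp
    simp_rw [this]
    rw [Finset.prod_ite, Finset.prod_const, Finset.prod_const_one, mul_one, overlap, mul_comm,
      Real.exp_nat_mul]
  have h2 : ∀ f : Fin m → Fin b, ∑ g : Fin m → Fin b, Real.exp (t * overlap f g) =
      (b + (Real.exp t - 1)) ^ m := by
    intro f
    simp_rw [h1]
    rw [← Fintype.prod_sum fun i j => (1 + if f i = j then Real.exp t - 1 else 0)]
    simp [Finset.sum_add_distrib]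
  simp [h2]

end Spikes

/-! ### The model with identity precision matrix -/

theorem one_mem_Theta {M₁ M₂ : ℝ} (hM₁ : 1 < M₁) {p k : ℕ} {β : Fin p → ℝ} (hβ : l0 β ≤ k) {σ : ℝ}
    (hσ : 0 < σ) (hσ' : σ ≤ M₂) : (⟨β, 1, σ⟩ : Param p) ∈ Theta M₁ M₂ k := by
  refine ⟨hβ, ⟨Matrix.isHermitian_one, fun i => ?_⟩, hσ, hσ'⟩
  have : Nonempty (Fin p) := ⟨i⟩
  have h := (Matrix.isHermitian_one (n := Fin p) (α := ℝ)).eigenvalues_mem_spectrum_real i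
  rw [spectrum.one_eq, Set.mem_singleton_iff] at h
  rw [h]
  exact ⟨(div_le_one (by linarith)).2 hM₁.le, hM₁.le⟩

theorem rowLaw_one {p : ℕ} (β : EuclideanSpace ℝ (Fin p)) (σ : ℝ) :
    rowLaw ⟨β.ofLp, 1, σ⟩ = ((stdGaussian (EuclideanSpace ℝ (Fin p))).prod
      (gaussianReal 0 (σ ^ 2).toNNReal)).map (fun w => (⟪β, w.1⟫ + w.2, w.1)) := by
  simp [rowLaw, PiLp.inner_apply]

instance {p : ℕ} (θ : Param p) : IsProbabilityMeasure (rowLaw θ) :=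
  Measure.isProbabilityMeasure_map (by fun_prop)

instance {n p : ℕ} (θ : Param p) : IsProbabilityMeasure (dataLaw n θ) := by
  unfold dataLaw; infer_instance

/-- With identity precision matrix, the law of the data has a product density with respect to the
law under `β = 0`. -/
theorem dataLaw_eq_withDensity (n : ℕ) {p : ℕ} (β : EuclideanSpace ℝ (Fin p)) {σ σ₀ : ℝ}
    (hσ : 0 < σ) (hσ₀ : 0 < σ₀) :
    dataLaw n ⟨β.ofLp, 1, σ⟩ = (dataLaw n ⟨0, 1, σ₀⟩).withDensity fun z =>
      ∏ i, likelihoodRatio (σ ^ 2).toNNReal (σ₀ ^ 2).toNNReal (fun x => ⟪β, x⟫) (z i) := by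
  have h0 : rowLaw (⟨0, 1, σ₀⟩ : Param p) = ((stdGaussian (EuclideanSpace ℝ (Fin p))).prod
      (gaussianReal 0 (σ₀ ^ 2).toNNReal)).map (fun w => (w.2, w.1)) := by
    simpa using rowLaw_one (0 : EuclideanSpace ℝ (Fin p)) σ₀
  have hrow : rowLaw ⟨β.ofLp, 1, σ⟩ = (rowLaw ⟨0, 1, σ₀⟩).withDensity
      (likelihoodRatio (σ ^ 2).toNNReal (σ₀ ^ 2).toNNReal fun x => ⟪β, x⟫) := by
    rw [h0, rowLaw_one, map_regression_eq_withDensity _ (by fun_prop)]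
    all_goals simpa [Real.toNNReal_eq_zero] using ne_of_gt ‹_›
  have : IsProbabilityMeasure ((rowLaw (⟨0, 1, σ₀⟩ : Param p)).withDensity
      (likelihoodRatio (σ ^ 2).toNNReal (σ₀ ^ 2).toNNReal fun x => ⟪β, x⟫)) := by
    rw [← hrow]; infer_instance
  rw [dataLaw, dataLaw, ← pi_withDensity _ (measurable_likelihoodRatio _ _ (by fun_prop)), hrow]

theorem lintegral_dataLaw_likelihoodRatio_mul (n : ℕ) {p : ℕ} (a b : EuclideanSpace ℝ (Fin p))
    {σ σ₀ : ℝ} (hσ : 0 < σ) (hσ₀ : 0 < σ₀) (ha : ‖a‖ ^ 2 + σ ^ 2 = σ₀ ^ 2)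
    (hb : ‖b‖ ^ 2 + σ ^ 2 = σ₀ ^ 2) :
    ∫⁻ z, (∏ i, likelihoodRatio (σ ^ 2).toNNReal (σ₀ ^ 2).toNNReal (fun x => ⟪a, x⟫) (z i)) *
        ∏ i, likelihoodRatio (σ ^ 2).toNNReal (σ₀ ^ 2).toNNReal (fun x => ⟪b, x⟫) (z i)
        ∂(dataLaw n ⟨0, 1, σ₀⟩) = ENNReal.ofReal (1 - ⟪a, b⟫ / σ₀ ^ 2)⁻¹ ^ n := by
  have h0 : rowLaw (⟨0, 1, σ₀⟩ : Param p) = ((stdGaussian (EuclideanSpace ℝ (Fin p))).prod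
      (gaussianReal 0 (σ₀ ^ 2).toNNReal)).map (fun w => (w.2, w.1)) := by
    simpa using rowLaw_one (0 : EuclideanSpace ℝ (Fin p)) σ₀
  simp_rw [← Finset.prod_mul_distrib]
  have hm : ∀ c : EuclideanSpace ℝ (Fin p), Measurable
      (likelihoodRatio (σ ^ 2).toNNReal (σ₀ ^ 2).toNNReal fun x => ⟪c, x⟫) := fun c =>
    measurable_likelihoodRatio _ _ (by fun_prop)
  rw [dataLaw]
  refine (lintegral_pi_prod (rowLaw (⟨0, 1, σ₀⟩ : Param p)) fun _ : Fin n =>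
    (hm a).mul (hm b)).trans ?_
  have e1 : ((σ ^ 2).toNNReal : ℝ) = σ ^ 2 := Real.coe_toNNReal _ (sq_nonneg _)
  have e2 : ((σ₀ ^ 2).toNNReal : ℝ) = σ₀ ^ 2 := Real.coe_toNNReal _ (sq_nonneg _)
  have := lintegral_likelihoodRatio_mul a b (v := (σ ^ 2).toNNReal) (v₀ := (σ₀ ^ 2).toNNReal)
    (by simpa [Real.toNNReal_eq_zero] using hσ.ne')
    (by simpa [Real.toNNReal_eq_zero] using hσ₀.ne') (by rw [e1, e2, ha]) (by rw [e1, e2, hb])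
  rw [← h0, e2] at this
  simp [this]

theorem inv_one_sub_le_exp {x : ℝ} (h0 : 0 ≤ x) (h1 : x ≤ 1 / 2) :
    (1 - x)⁻¹ ≤ Real.exp (2 * x) := by
  have h2 : (1 - x)⁻¹ ≤ 1 + 2 * x := by
    rw [inv_le_iff_one_le_mul₀ (by linarith)]
    nlinarith
  linarith [Real.add_one_le_exp (2 * x)]

/-! ### From indistinguishability to interval length -/

/-- An interval that covers `0` under `μ` and whose upper end exceeds `d` with large probability
is long. -/
theorem mul_le_lintegral_length {Ω : Type*} [MeasurableSpace Ω] (μ : Measure Ω)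
    [IsProbabilityMeasure μ] {l u : Ω → ℝ} (hl : Measurable l) (hu : Measurable u) {d α ε : ℝ}
    (hd : 0 ≤ d) (hα : α ≤ 1) (hε : 0 ≤ ε)
    (hcov : ENNReal.ofReal (1 - α) ≤ μ {z | l z ≤ 0 ∧ 0 ≤ u z})
    (hup : ENNReal.ofReal (1 - α) ≤ μ {z | d ≤ u z} + ENNReal.ofReal ε) :
    ENNReal.ofReal (d * (1 - 2 * α - ε)) ≤ ∫⁻ z, ENNReal.ofReal (u z - l z) ∂μ := by
  set A := {z | l z ≤ 0 ∧ 0 ≤ u z}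
  set B := {z | d ≤ u z}
  have hA : MeasurableSet A :=
    (measurableSet_le hl measurable_const).inter (measurableSet_le measurable_const hu)
  have hB : MeasurableSet B := measurableSet_le measurable_const hu
  have hAB : ENNReal.ofReal (1 - 2 * α - ε) ≤ μ (A ∩ B) := by
    -- Inclusion–exclusion: both events are likely, so they occur together with probability at least
    -- `1 - 2α - ε`.
    have h1 : μ A + μ B ≤ 1 + μ (A ∩ B) := by
      rw [← measure_union_add_inter A hB]
      gcongr
      exact prob_le_one
    have h2 : ENNReal.ofReal (1 - α + (1 - α)) ≤ 1 + μ (A ∩ B) + ENNReal.ofReal ε := by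
      rw [ENNReal.ofReal_add (by linarith) (by linarith)]
      calc _ ≤ μ A + (μ B + ENNReal.ofReal ε) := add_le_add hcov hup
        _ = (μ A + μ B) + ENNReal.ofReal ε := by rw [add_assoc]
        _ ≤ _ := by gcongr
    obtain ⟨x, hx0, hx⟩ : ∃ x : ℝ, 0 ≤ x ∧ μ (A ∩ B) = ENNReal.ofReal x :=
      ⟨(μ (A ∩ B)).toReal, ENNReal.toReal_nonneg,
        (ENNReal.ofReal_toReal (measure_ne_top _ _)).symm⟩
    rw [hx, ← ENNReal.ofReal_one, ← ENNReal.ofReal_add one_pos.le hx0,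
      ← ENNReal.ofReal_add (by linarith) hε, ENNReal.ofReal_le_ofReal_iff (by linarith)] at h2
    rw [hx]
    exact ENNReal.ofReal_le_ofReal (by linarith)
  calc ENNReal.ofReal (d * (1 - 2 * α - ε))
      = ENNReal.ofReal d * ENNReal.ofReal (1 - 2 * α - ε) := ENNReal.ofReal_mul hd
    _ ≤ ENNReal.ofReal d * μ (A ∩ B) := by gcongr
    _ = ∫⁻ _ in A ∩ B, ENNReal.ofReal d ∂μ := by rw [setLIntegral_const]
    _ ≤ ∫⁻ z in A ∩ B, ENNReal.ofReal (u z - l z) ∂μ := by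
        refine setLIntegral_mono' (hA.inter hB) fun z hz => ENNReal.ofReal_le_ofReal ?_
        have h1 : l z ≤ 0 := hz.1.1
        have h2 : d ≤ u z := hz.2
        linarith
    _ ≤ _ := setLIntegral_le_lintegral _ _

/-- The lower bound given by the prior that puts a spike of height `ρ` at a uniform position in each
of `m` blocks of size `b` of coordinates at which `|ξ| ≥ w`. -/
theorem le_benchmark_of_blocks {M₁ M₂ α : ℝ} (hM₁ : 1 < M₁) (hM₂ : 0 < M₂) (hα : α ≤ 1)
    {n p k₁ k m b : ℕ} (hm : m ≤ k) (hb : 0 < b) (e : Fin m × Fin b ↪ Fin p) {ξ : Fin p → ℝ}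
    {w : ℝ} (hw : 0 < w) (hξ : ∀ x, w ≤ |ξ (e x)|) {ρ : ℝ} (hρ : 0 ≤ ρ)
    (hmρ : m * ρ ^ 2 ≤ M₂ ^ 2 / 2) {ε : ℝ} (hε : 0 < ε)
    (hexp : Real.exp (m * (Real.exp (2 * n * ρ ^ 2 / M₂ ^ 2) - 1) / b) ≤ 1 + ε ^ 2) :
    ENNReal.ofReal (ρ * m * w * (1 - 2 * α - ε)) ≤
      benchmark α n (Theta M₁ M₂ k₁) (Theta M₁ M₂ k) (fun β => ∑ j, ξ j * β j) := by
  have hM₂sq : 0 < M₂ ^ 2 := by positivity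
  set a : Fin p → ℝ := fun j => ρ * (ξ j / |ξ j|) with ha_def
  have hpos : ∀ x, 0 < |ξ (e x)| := fun x => hw.trans_le (hξ x)
  have ha : ∀ x, a (e x) ^ 2 = ρ ^ 2 := fun x => by
    rw [ha_def, mul_pow, div_pow, sq_abs, div_self (by have := hpos x; simpa using this), mul_one]
  have hξa : ∀ x, ρ * w ≤ ξ (e x) * a (e x) := fun x => by
    have : ξ (e x) * a (e x) = ρ * |ξ (e x)| := by
      have h2 : ξ (e x) * (ξ (e x) / |ξ (e x)|) = |ξ (e x)| := by
        rw [← mul_div_assoc, div_eq_iff (hpos x).ne', ← sq, ← sq, sq_abs]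
      rw [ha_def, mul_left_comm, h2]
    rw [this]
    exact mul_le_mul_of_nonneg_left (hξ x) hρ
  -- This choice keeps the response variance at `M₂²`; `hmρ` keeps it positive and bounds the
  -- correlations by `1/2`.
  set σ := √(M₂ ^ 2 - m * ρ ^ 2)
  have hσ : 0 < σ := Real.sqrt_pos.2 (by linarith)
  have hσsq : σ ^ 2 = M₂ ^ 2 - m * ρ ^ 2 := Real.sq_sqrt (by linarith)
  have hσM : σ ≤ M₂ := by
    rw [← abs_of_pos hσ, ← abs_of_pos hM₂, ← sq_le_sq, hσsq]
    have : 0 ≤ m * ρ ^ 2 := by positivity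
    linarith
  have hnorm : ∀ f, ‖spikes e a f‖ ^ 2 + σ ^ 2 = M₂ ^ 2 := fun f => by
    rw [norm_sq_spikes e ha, hσsq]; ring
  let L : (Fin m → Fin b) → Data n p → ℝ≥0∞ := fun f z =>
    ∏ i, likelihoodRatio (σ ^ 2).toNNReal (M₂ ^ 2).toNNReal (fun x => ⟪spikes e a f, x⟫) (z i)
  have hL : ∀ f, Measurable (L f) := fun f =>
    Finset.measurable_prod _ fun i _ => (measurable_likelihoodRatio _ _ (by fun_prop)).comp
      (measurable_pi_apply i)
  have hdens : ∀ f, dataLaw n ⟨(spikes e a f).ofLp, 1, σ⟩ =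
      (dataLaw n ⟨0, 1, M₂⟩).withDensity (L f) := fun f =>
    dataLaw_eq_withDensity n (spikes e a f) hσ hM₂
  have h1 : ∀ f, ∫⁻ z, L f z ∂(dataLaw n ⟨0, 1, M₂⟩) = 1 := fun f => by
    rw [← setLIntegral_univ, ← withDensity_apply _ MeasurableSet.univ, ← hdens, measure_univ]
  have : Nonempty (Fin m → Fin b) := ⟨fun _ => ⟨0, hb⟩⟩
  set t := 2 * n * ρ ^ 2 / M₂ ^ 2 with ht
  have hLL : ∀ f g, ∫⁻ z, L f z * L g z ∂(dataLaw n ⟨0, 1, M₂⟩) ≤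
      ENNReal.ofReal (Real.exp (t * overlap f g)) := fun f g => by
    rw [lintegral_dataLaw_likelihoodRatio_mul n _ _ hσ hM₂ (hnorm f) (hnorm g),
      inner_spikes e ha]
    have hx1 : overlap f g * ρ ^ 2 / M₂ ^ 2 ≤ 1 / 2 := by
      rw [div_le_iff₀ hM₂sq]
      have : (overlap f g : ℝ) ≤ m := by exact_mod_cast overlap_le f g
      nlinarith [mul_le_mul_of_nonneg_right this (sq_nonneg ρ)]
    have hinv : 0 ≤ (1 - overlap f g * ρ ^ 2 / M₂ ^ 2)⁻¹ := inv_nonneg.2 (by linarith)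
    rw [← ENNReal.ofReal_pow hinv]
    refine ENNReal.ofReal_le_ofReal ?_
    refine (pow_le_pow_left₀ hinv (inv_one_sub_le_exp (by positivity) hx1) n).trans_eq ?_
    rw [← Real.exp_nat_mul]
    congr 1
    rw [ht]; ring
  have h2 : ∑ f, ∑ g, ∫⁻ z, L f z * L g z ∂(dataLaw n ⟨0, 1, M₂⟩) ≤
      (Fintype.card (Fin m → Fin b) : ℝ≥0∞) ^ 2 * ENNReal.ofReal (1 + ε ^ 2) := by
    have hbR : (0 : ℝ) < b := by exact_mod_cast hb
    calc _ ≤ ∑ f : Fin m → Fin b, ∑ g : Fin m → Fin b,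
          ENNReal.ofReal (Real.exp (t * overlap f g)) := by
          gcongr with f _ g _
          exact hLL f g
      _ = ENNReal.ofReal ((b : ℝ) ^ m * (b + (Real.exp t - 1)) ^ m) := by
          rw [← sum_exp_overlap, ENNReal.ofReal_sum_of_nonneg fun f _ => by positivity]
          refine Finset.sum_congr rfl fun f _ => ?_
          rw [ENNReal.ofReal_sum_of_nonneg fun g _ => by positivity]
      _ ≤ ENNReal.ofReal (((b : ℝ) ^ m) ^ 2 * (1 + ε ^ 2)) := by
          refine ENNReal.ofReal_le_ofReal ?_
          have hq : (b : ℝ) + (Real.exp t - 1) = b * ((Real.exp t - 1) / b + 1) := by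
            field_simp
            ring
          have ht0 : 0 ≤ Real.exp t - 1 := by
            have : 0 ≤ t := by positivity
            linarith [Real.add_one_le_exp t]
          rw [hq, mul_pow, ← mul_assoc, ← sq]
          gcongr
          refine (pow_le_pow_left₀ (by positivity) (Real.add_one_le_exp _) m).trans ?_
          rw [← Real.exp_nat_mul, ← mul_div_assoc]
          exact hexp
      _ = _ := by
          rw [ENNReal.ofReal_mul (by positivity), ENNReal.ofReal_pow (by positivity),
            ENNReal.ofReal_pow (by positivity), ENNReal.ofReal_natCast]
          simp
  refine le_iInf₂ fun I hI => ?_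
  have hθ₀ : (⟨0, 1, M₂⟩ : Param p) ∈ Theta M₁ M₂ k₁ :=
    one_mem_Theta hM₁ (by simp [l0]) hM₂ le_rfl
  refine le_trans ?_ (le_iSup₂_of_le (⟨0, 1, M₂⟩ : Param p) hθ₀ le_rfl)
  refine mul_le_lintegral_length _ I.measurable_l I.measurable_u (by positivity) hα hε.le ?_ ?_
  · simpa using hI ⟨0, 1, M₂⟩ (one_mem_Theta hM₁ (by simp [l0]) hM₂ le_rfl)
  · refine le_measure_add_of_second_moment _ hL h1 hε h2
      (measurableSet_le measurable_const I.measurable_u) fun f => ?_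
    rw [← hdens]
    refine (hI ⟨(spikes e a f).ofLp, 1, σ⟩
      (one_mem_Theta hM₁ ((l0_spikes_le e a f).trans hm) hσ hσM)).trans (measure_mono ?_)
    intro z hz
    -- Covering the signal under an alternative forces the upper end above `ρ * m * w`, a level
    -- common to all alternatives.
    refine le_trans ?_ hz.2
    simp only [sum_mul_spikes]
    calc ρ * m * w = ∑ _i : Fin m, ρ * w := by simp; ring
      _ ≤ _ := Finset.sum_le_sum fun i _ => hξa _

/-- The support of a dense loading contains `m` disjoint blocks of `b` coordinates at which the
loading is of the order of its norm. -/
theorem exists_blocks_of_mem_Loading {p q m b : ℕ} {cbar : ℝ} (hcbar : 1 ≤ cbar) {ξ : Fin p → ℝ}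
    (hξ : ξ ∈ Loading q cbar) (hmb : m * b ≤ q) :
    ∃ e : Fin m × Fin b ↪ Fin p, ∀ x, ‖ξ‖ / cbar ≤ |ξ (e x)| := by
  obtain ⟨hq, -, hratio⟩ := hξ
  have hcard : Fintype.card (Fin m × Fin b) ≤ Fintype.card {j // ξ j ≠ 0} := by
    rw [Fintype.card_subtype, Fintype.card_prod, Fintype.card_fin, Fintype.card_fin]
    exact hmb.trans_eq hq.symm
  obtain ⟨e⟩ := Function.Embedding.nonempty_of_card_le hcard
  refine ⟨e.trans (Function.Embedding.subtype _), fun x => ?_⟩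
  have hx : ξ (e x) ≠ 0 := (e x).2
  change ‖ξ‖ / cbar ≤ |ξ (e x)|
  rw [div_le_iff₀ (by linarith), mul_comm, pi_norm_le_iff_of_nonneg (by positivity)]
  intro i
  rw [Real.norm_eq_abs]
  by_cases hi : ξ i = 0
  · rw [hi, abs_zero]; positivity
  · exact (div_le_iff₀ (abs_pos.2 hx)).1 (hratio i _ hi hx)

/-! ### Large dimension and the parametric regime -/

/-- The lower bound for large `p`, with one spike in each of `k` blocks. -/
theorem le_benchmark_of_large_dim {M₁ M₂ α : ℝ} (hM₁ : 1 < M₁) (hM₂ : 0 < M₂) (hα : α ≤ 1)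
    {c cq γ γq cbar δ t ε : ℝ} (hc : 0 < c) (hcq : 0 < cq) (hcbar : 1 ≤ cbar)
    (hδ : 2 * δ = γq - 2 * γ) (hδ₀ : 0 ≤ δ) (ht₀ : 0 ≤ t) (htδ : 2 * t ≤ δ) (htc : t * c ≤ 1 / 2)
    (hε : 0 < ε) {n p k₁ k q : ℕ} {ξ : Fin p → ℝ} (hn : 1 ≤ n) (hp : 2 ≤ p)
    (hk : 1 ≤ k) (hkγ : (k : ℝ) ≤ c * (p : ℝ) ^ γ) (hkn : (k : ℝ) ≤ c * (n / Real.log p))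
    (hq : cq * (p : ℝ) ^ γq ≤ q) (hξ : ξ ∈ Loading q cbar)
    (hlarge : 2 * c ^ 2 / cq * (p : ℝ) ^ (-δ) ≤ min (Real.log (1 + ε ^ 2)) 1) :
    ENNReal.ofReal (M₂ * √(t * Real.log p / n) * k * (‖ξ‖ / cbar) * (1 - 2 * α - ε)) ≤
      benchmark α n (Theta M₁ M₂ k₁) (Theta M₁ M₂ k) (fun β => ∑ j, ξ j * β j) := by
  have hp0 : (0 : ℝ) < p := by positivity
  have hp1 : (1 : ℝ) ≤ p := by exact_mod_cast (by omega : 1 ≤ p)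
  have hn0 : (0 : ℝ) < n := by exact_mod_cast hn
  have hk0 : (0 : ℝ) < k := by exact_mod_cast hk
  have hlog : 0 < Real.log p := Real.log_pos (by exact_mod_cast (by omega : 1 < p))
  have hq0 : (0 : ℝ) < q := lt_of_lt_of_le (by positivity) hq
  -- The gap `γq - 2γ = 2δ` is split: one `δ` pays for the exponential factor `p ^ δ`, the other
  -- leaves the decay `p ^ (-δ)`.
  have hmain : 2 * (k : ℝ) ^ 2 * (p : ℝ) ^ δ / q ≤ min (Real.log (1 + ε ^ 2)) 1 := by
    refine le_trans ?_ hlarge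
    calc 2 * (k : ℝ) ^ 2 * (p : ℝ) ^ δ / q
        ≤ 2 * (c * (p : ℝ) ^ γ) ^ 2 * (p : ℝ) ^ δ / (cq * (p : ℝ) ^ γq) := by gcongr
      _ = 2 * c ^ 2 / cq * (p : ℝ) ^ (-δ) := by
        have : (p : ℝ) ^ γq = (p : ℝ) ^ γ * (p : ℝ) ^ γ * (p : ℝ) ^ δ * (p : ℝ) ^ δ := by
          rw [← Real.rpow_add hp0, ← Real.rpow_add hp0, ← Real.rpow_add hp0]
          congr 1
          linarith
        rw [this, Real.rpow_neg hp0.le]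
        have h1 : (p : ℝ) ^ γ ≠ 0 := by positivity
        have h2 : (p : ℝ) ^ δ ≠ 0 := by positivity
        field_simp
  have hkq : k ≤ q := by
    have h1 := hmain.trans (min_le_right _ _)
    rw [div_le_one hq0] at h1
    have h2 : 1 ≤ (p : ℝ) ^ δ := Real.one_le_rpow hp1 hδ₀
    have h3 : (1 : ℝ) ≤ k := by exact_mod_cast hk
    have : (k : ℝ) ≤ q := by
      have h4 : (k : ℝ) ≤ k ^ 2 := by nlinarith
      have h5 : 2 * (k : ℝ) ^ 2 * 1 ≤ 2 * (k : ℝ) ^ 2 * (p : ℝ) ^ δ := by gcongr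
      nlinarith
    exact_mod_cast this
  have hb : 0 < q / k := Nat.div_pos hkq hk
  obtain ⟨e, he⟩ := exists_blocks_of_mem_Loading (m := k) (b := q / k) hcbar hξ
    (Nat.mul_div_le q k)
  have hξ0 : 0 < ‖ξ‖ := norm_pos_iff.2 hξ.2.1
  have hρsq : (M₂ * √(t * Real.log p / n)) ^ 2 = M₂ ^ 2 * (t * Real.log p / n) := by
    rw [mul_pow, Real.sq_sqrt (by positivity)]
  refine le_benchmark_of_blocks hM₁ hM₂ hα le_rfl hb e (by positivity) he (by positivity) ?_ hε ?_
  · rw [hρsq]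
    have h1 : (k : ℝ) * Real.log p / n ≤ c := by
      rw [mul_div_assoc', le_div_iff₀ hlog] at hkn
      rwa [div_le_iff₀ hn0]
    calc (k : ℝ) * (M₂ ^ 2 * (t * Real.log p / n))
        = M₂ ^ 2 * (t * ((k : ℝ) * Real.log p / n)) := by ring
      _ ≤ M₂ ^ 2 * (t * c) := by gcongr
      _ ≤ M₂ ^ 2 * (1 / 2) := by gcongr
      _ = _ := by ring
  · rw [hρsq, ← Real.le_log_iff_exp_le (by positivity)]
    refine le_trans ?_ (hmain.trans (min_le_left _ _))
    have hE : Real.exp (2 * n * (M₂ ^ 2 * (t * Real.log p / n)) / M₂ ^ 2) ≤ (p : ℝ) ^ δ := by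
      have : 2 * n * (M₂ ^ 2 * (t * Real.log p / n)) / M₂ ^ 2 = Real.log p * (2 * t) := by
        field_simp
      rw [this, ← Real.rpow_def_of_pos hp0]
      exact Real.rpow_le_rpow_of_exponent_le hp1 htδ
    -- Rounding `q / k` down loses at most a factor of two, because the quotient is at least one.
    have hbq : (q : ℝ) ≤ 2 * k * (q / k : ℕ) := by
      have h1 : q < k * (q / k) + k := Nat.lt_mul_div_succ q hk
      have h2 : k * 1 ≤ k * (q / k) := Nat.mul_le_mul_left k hb
      have : q ≤ 2 * k * (q / k) := by nlinarith
      exact_mod_cast this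
    have hbR : (0 : ℝ) < (q / k : ℕ) := by exact_mod_cast hb
    rw [div_le_div_iff₀ hbR hq0]
    have hP : (0 : ℝ) < (p : ℝ) ^ δ := by positivity
    calc _ ≤ k * (p : ℝ) ^ δ * q := by gcongr; linarith
      _ ≤ k * (p : ℝ) ^ δ * (2 * k * (q / k : ℕ)) := by gcongr
      _ = _ := by ring

/-- The parametric lower bound, with a single spike. -/
theorem le_benchmark_parametric {M₁ M₂ α : ℝ} (hM₁ : 1 < M₁) (hM₂ : 0 < M₂) (hα : α ≤ 1)
    {cbar s ε : ℝ} (hcbar : 1 ≤ cbar) (hs : 0 ≤ s) (hs' : s ≤ 1 / 2) (hε : 0 < ε)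
    (hsε : Real.exp (2 * s) - 1 ≤ Real.log (1 + ε ^ 2))
    {n p k₁ k q : ℕ} {ξ : Fin p → ℝ} (hn : 1 ≤ n) (hk : 1 ≤ k) (hq : 1 ≤ q)
    (hξ : ξ ∈ Loading q cbar) :
    ENNReal.ofReal (M₂ * √(s / n) * (‖ξ‖ / cbar) * (1 - 2 * α - ε)) ≤
      benchmark α n (Theta M₁ M₂ k₁) (Theta M₁ M₂ k) (fun β => ∑ j, ξ j * β j) := by
  have hn1 : (1 : ℝ) ≤ n := by exact_mod_cast hn
  obtain ⟨e, he⟩ := exists_blocks_of_mem_Loading (m := 1) (b := 1) hcbar hξ (by simpa using hq)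
  have hξ0 : 0 < ‖ξ‖ := norm_pos_iff.2 hξ.2.1
  have hρsq : (M₂ * √(s / n)) ^ 2 = M₂ ^ 2 * (s / n) := by
    rw [mul_pow, Real.sq_sqrt (by positivity)]
  have := le_benchmark_of_blocks (n := n) (k₁ := k₁) (ρ := M₂ * √(s / n)) hM₁ hM₂ hα hk one_pos e
    (by positivity) he (by positivity) ?_ hε ?_
  · simpa using this
  · rw [hρsq, Nat.cast_one, one_mul]
    have : s / n ≤ 1 / 2 := (div_le_self hs hn1).trans hs'
    nlinarith [sq_nonneg M₂]
  · rw [hρsq, ← Real.le_log_iff_exp_le (by positivity)]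
    have : 2 * n * (M₂ ^ 2 * (s / n)) / M₂ ^ 2 = 2 * s := by field_simp
    rw [this]
    simpa using hsε

end HDRegression

end

open HDRegression in
/-- For `ξ : Fin p → ℝ`, `‖ξ‖` is the sup norm `max_j |ξ j|`. -/
theorem theorem5
    (M₁ M₂ : ℝ) (hM₁ : 1 < M₁) (hM₂ : 0 < M₂)
    (α : ℝ) (hα₀ : 0 < α) (hα : α < 1 / 2)
    (c : ℝ) (hc : 0 < c) (γ : ℝ) (hγ₀ : 0 ≤ γ) (hγ : γ < 1 / 2)
    (cq : ℝ) (hcq : 0 < cq) (γq : ℝ) (hγq : 2 * γ < γq) (hγq₁ : γq ≤ 1)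
    (cbar : ℝ) (hcbar : 1 ≤ cbar) :
    ∃ c₁ : ℝ, 0 < c₁ ∧
      ∀ (n p k₁ k q : ℕ) (ξ : Fin p → ℝ), 1 ≤ n → 2 ≤ p →
        k₁ ≤ k →
        (k : ℝ) ≤ c * min ((p : ℝ) ^ γ) ((n : ℝ) / Real.log (p : ℝ)) →
        cq * (p : ℝ) ^ γq ≤ (q : ℝ) →
        ξ ∈ Loading q cbar →
        ENNReal.ofReal (c₁ * ‖ξ‖ * (k : ℝ) * Real.sqrt (Real.log (p : ℝ) / (n : ℝ))) ≤
          benchmark α n (Theta M₁ M₂ k₁) (Theta M₁ M₂ k) (fun β => ∑ j, ξ j * β j) := by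
  obtain ⟨ε, hεdef⟩ : ∃ ε : ℝ, ε = (1 - 2 * α) / 2 := ⟨_, rfl⟩
  obtain ⟨δ, hδdef⟩ : ∃ δ : ℝ, 2 * δ = γq - 2 * γ := ⟨(γq - 2 * γ) / 2, by ring⟩
  have hε : 0 < ε := by linarith
  have hεeq : 1 - 2 * α - ε = ε := by linarith
  have hδ : 0 < δ := by linarith
  have hη : 0 < Real.log (1 + ε ^ 2) := Real.log_pos (by nlinarith)
  -- `2 * t ≤ δ` controls the exponential moment; `t * c ≤ 1 / 2`, with `k log p / n ≤ c`, keeps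
  -- `‖β‖² ≤ M₂²/2`.
  obtain ⟨t, ht, htδ, htc⟩ : ∃ t : ℝ, 0 < t ∧ 2 * t ≤ δ ∧ t * c ≤ 1 / 2 := by
    refine ⟨min (δ / 2) (1 / 2 / c), by positivity, ?_, ?_⟩
    · linarith [min_le_left (δ / 2) (1 / 2 / c)]
    · exact (le_div_iff₀ hc).1 (min_le_right _ _)
  obtain ⟨s, hs, hs', hsε⟩ : ∃ s : ℝ, 0 < s ∧ s ≤ 1 / 2 ∧
      Real.exp (2 * s) - 1 ≤ Real.log (1 + ε ^ 2) := by
    have hl : 0 < Real.log (1 + Real.log (1 + ε ^ 2)) := Real.log_pos (by linarith)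
    refine ⟨min (1 / 2) (Real.log (1 + Real.log (1 + ε ^ 2)) / 2), by positivity,
      min_le_left _ _, ?_⟩
    have h1 : 2 * min (1 / 2) (Real.log (1 + Real.log (1 + ε ^ 2)) / 2) ≤
        Real.log (1 + Real.log (1 + ε ^ 2)) := by
      linarith [min_le_right (1 / 2) (Real.log (1 + Real.log (1 + ε ^ 2)) / 2)]
    have h2 := Real.exp_le_exp.2 h1
    rw [Real.exp_log (by linarith)] at h2
    linarith
  obtain ⟨R, hR1, hR⟩ : ∃ R : ℝ, 1 ≤ R ∧ ∀ x : ℝ, R ≤ x →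
      2 * c ^ 2 / cq * x ^ (-δ) ≤ min (Real.log (1 + ε ^ 2)) 1 := by
    have hlim : Filter.Tendsto (fun x : ℝ => 2 * c ^ 2 / cq * x ^ (-δ)) Filter.atTop
        (nhds (2 * c ^ 2 / cq * 0)) := (tendsto_rpow_neg_atTop hδ).const_mul _
    rw [mul_zero] at hlim
    obtain ⟨R, hR⟩ := Filter.eventually_atTop.1
      (hlim.eventually_le_const (lt_min hη one_pos))
    exact ⟨max R 1, le_max_right _ _, fun x hx => hR x ((le_max_left _ _).trans hx)⟩
  have hR0 : 0 < R := by linarith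
  have hcb : 0 < cbar := by linarith
  -- The two entries of the minimum serve `p ≥ R` and `p < R`; in the second, `c * R` bounds `k` and
  -- `√R` bounds `√(log p)`.
  refine ⟨M₂ * ε / cbar * min √t (√s / (c * R * √R)), by positivity, ?_⟩
  intro n p k₁ k q ξ hn hp _ hk hq hξ
  rcases Nat.eq_zero_or_pos k with rfl | hk1
  · simp
  have hkγ : (k : ℝ) ≤ c * (p : ℝ) ^ γ :=
    hk.trans (mul_le_mul_of_nonneg_left (min_le_left _ _) hc.le)
  have hkn : (k : ℝ) ≤ c * (n / Real.log p) :=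
    hk.trans (mul_le_mul_of_nonneg_left (min_le_right _ _) hc.le)
  have hp0 : (0 : ℝ) < p := by positivity
  have hp1 : (1 : ℝ) ≤ p := by exact_mod_cast (by omega : 1 ≤ p)
  have hq0 : 1 ≤ q := by
    have : (0 : ℝ) < q := lt_of_lt_of_le (by positivity) hq
    exact_mod_cast this
  have hlog : 0 ≤ Real.log p := Real.log_nonneg hp1
  rcases le_or_gt R p with hRp | hRp
  · refine le_trans (ENNReal.ofReal_le_ofReal ?_)
      (le_benchmark_of_large_dim hM₁ hM₂ (by linarith) hc hcq hcbar hδdef hδ.le ht.le htδ htc hε hn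
        hp hk1 hkγ hkn hq hξ (hR p hRp))
    rw [hεeq, mul_div_assoc t, Real.sqrt_mul ht.le]
    calc _ ≤ M₂ * ε / cbar * √t * ‖ξ‖ * k * √(Real.log p / n) := by
          gcongr
          exact min_le_left _ _
      _ = _ := by ring
  · refine le_trans (ENNReal.ofReal_le_ofReal ?_)
      (le_benchmark_parametric hM₁ hM₂ (by linarith) hcbar hs.le hs' hε hsε hn hk1 hq0 hξ)
    rw [hεeq, Real.sqrt_div hs.le, Real.sqrt_div hlog]
    have hkR : (k : ℝ) ≤ c * R := by
      refine hkγ.trans (mul_le_mul_of_nonneg_left ?_ hc.le)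
      calc (p : ℝ) ^ γ ≤ (p : ℝ) ^ (1 : ℝ) :=
            Real.rpow_le_rpow_of_exponent_le hp1 (by linarith)
        _ ≤ R := by rw [Real.rpow_one]; exact hRp.le
    have hlR : Real.log p ≤ R := by linarith [Real.log_le_sub_one_of_pos hp0]
    calc _ ≤ M₂ * ε / cbar * (√s / (c * R * √R)) * ‖ξ‖ * (c * R) * (√R / √n) := by
          gcongr
          exact min_le_right _ _
      _ = _ := by
          have : √R ≠ 0 := (Real.sqrt_pos.2 hR0).ne'
          field_simp
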